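/- Conventions. For a based space $(B,b)$ and $n\ge 1$, the Gottlieb group $G_n(B)\subseteq\pi_n(B)$ is the subgroup of classes of based maps $a:S^n\to B$ such that $(a\,|\,\mathrm{id}_B):S^n\vee B\to B$ extends to a map $S^n\times B\to B$. For a based map $f:E\to B$ put $$O_n(f)=\operatorname{Im}\bigl(G_n(E)\xrightarrow{\ \pi_n(f)\ }\pi_n(B)\twoheadrightarrow\pi_n(B)/G_n(B)\bigr),\qquad O(f)=\bigoplus_{n>0}O_n(f).$$ A rationalization of a simply connected space $X$ is a based map $\eta_X:X\to X_{\mathbb Q}$ to a simply connected CW complex such that, for all $n\ge 2$, $\pi_n(X_{\mathbb Q})$ is a rational vector space and $\pi_n(\eta_X)$ induces an isomorphism $\pi_n(X)\otimes\mathbb Q\cong\pi_n(X_{\mathbb Q})$. A rationalization of a based map $f:X\to Y$, with respect to given rationalizations $\eta_X$ and $\eta_Y$, is a based map $f_{\mathbb Q}:X_{\mathbb Q}\to Y_{\mathbb Q}$ with $f_{\mathbb Q}\circ\eta_X\simeq\eta_Y\circ f$ (based homotopy). Put $$o(f)=\dim_{\mathbb Q}\bigl(O(f_{\mathbb Q})\otimes\mathbb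 Q\bigr)\in\{0,1,2,\dots,\infty\},$$ which is $\dim_{\mathbb Q}O(f_{\mathbb Q})$ because $O(f_{\mathbb Q})$ is a rational vector space. Theorem 1.2. Let $X$, $Y$, $Z$ be simply connected CW complexes whose rational homology is finite-dimensional in each degree, with rationalizations $\eta_X,\eta_Y,\eta_Z$, and let $f:Y\to Z$ and $g:X\to Y$ be based maps. Then, for any rationalizations $f_{\mathbb Q}$, $g_{\mathbb Q}$ and $(f\circ g)_{\mathbb Q}$ of $f$, $g$ and $f\circ g$ used to compute $o$, $$o(f\circ g)\le o(f)+o(g).$$ -/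

import Mathlib

open scoped Topology Topology.Homotopy unitInterval TensorProduct DirectSum

noncomputable section

namespace GottliebObstruction

universe u v w

/-! ### Based maps and the homomorphisms they induce on homotopy groups -/

section Based

variable {X : Type u} {Y : Type v} {Z : Type w}
  [TopologicalSpace X] [TopologicalSpace Y] [TopologicalSpace Z]

/-- A based map `(X, x) → (Y, y)`. -/
structure BasedMap (x : X) (y : Y) where
  /-- The underlying continuous map. -/
  toMap : C(X, Y)
  map_base : toMap x = y

/-- The composite `f ∘ g` of based maps. -/
def BasedMap.comp {x : X} {y : Y} {z : Z} (f : BasedMap y z) (g : BasedMap x y) :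
    BasedMap x z where
  toMap := f.toMap.comp g.toMap
  map_base := by simp [g.map_base, f.map_base]

/-- Based homotopy: homotopy relative to the base point. -/
def BasedMap.Homotopic {x : X} {y : Y} (f g : BasedMap x y) : Prop :=
  f.toMap.HomotopicRel g.toMap {x}

/-- The class in `π_n(X, x)` of a based map `a : (I^n, ∂I^n) → (X, x)`. -/
def piMk {x : X} (n : ℕ) (a : Ω^ (Fin n) X x) : π_ n X x :=
  Quotient.mk (GenLoop.Homotopic.setoid (Fin n) x) a

theorem piMk_surjective {x : X} (n : ℕ) : Function.Surjective (piMk n (x := x)) :=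
  Quotient.mk_surjective

theorem piMk_mul {x : X} (n : ℕ) (a a' : Ω^ (Fin (n + 1)) X x) :
    piMk (n + 1) a * piMk (n + 1) a' = piMk (n + 1) (GenLoop.transAt 0 a' a) :=
  HomotopyGroup.mul_spec

theorem piMk_inv {x : X} (n : ℕ) (a : Ω^ (Fin (n + 1)) X x) :
    (piMk (n + 1) a)⁻¹ = piMk (n + 1) (GenLoop.symmAt 0 a) :=
  HomotopyGroup.inv_spec

/-- The composite of a based map `(I^n, ∂I^n) → (X, x)` with a based map `(X, x) → (Y, y)`. -/
def genLoopMap {x : X} {y : Y} (n : ℕ) (f : BasedMap x y) (a : Ω^ (Fin n) X x) :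
    Ω^ (Fin n) Y y :=
  ⟨f.toMap.comp a.1, fun t ht => by
    change f.toMap (a t) = y
    rw [GenLoop.boundary a t ht, f.map_base]⟩

theorem genLoopMap_transAt {x : X} {y : Y} (n : ℕ) (i : Fin n) (f : BasedMap x y)
    (a a' : Ω^ (Fin n) X x) : genLoopMap n f (GenLoop.transAt i a a')
      = GenLoop.transAt i (genLoopMap n f a) (genLoopMap n f a') := by
  ext t
  change f.toMap (ite _ _ _) = ite _ _ _
  split_ifs <;> rfl

/-- The homomorphism `π_{n+1}(f) : π_{n+1}(X, x) → π_{n+1}(Y, y)`, `[a] ↦ [f ∘ a]`. -/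
def piMap {x : X} {y : Y} (n : ℕ) (f : BasedMap x y) : π_ (n + 1) X x →* π_ (n + 1) Y y :=
  MonoidHom.mk'
    (Quotient.lift (fun a => piMk (n + 1) (genLoopMap (n + 1) f a)) fun a a' h =>
      Quotient.sound (ContinuousMap.HomotopicRel.comp_continuousMap
        (show a.1.HomotopicRel a'.1 _ from h) f.toMap))
    (by
      intro α β
      obtain ⟨a, rfl⟩ := piMk_surjective _ α
      obtain ⟨a', rfl⟩ := piMk_surjective _ β
      rw [piMk_mul]
      change piMk (n + 1) _ = piMk (n + 1) _ * piMk (n + 1) _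
      rw [piMk_mul, genLoopMap_transAt])

theorem piMap_piMk {x : X} {y : Y} (n : ℕ) (f : BasedMap x y) (a : Ω^ (Fin (n + 1)) X x) :
    piMap n f (piMk (n + 1) a) = piMk (n + 1) (genLoopMap (n + 1) f a) :=
  rfl

end Based

/-! ### Gottlieb groups -/

section Gottlieb

variable {B : Type u} [TopologicalSpace B]

/-- `a : (I^n, ∂I^n) → (B, b)`, regarded as a based map `S^n = I^n/∂I^n → B`, is such that
`(a | id_B) : S^n ∨ B → B` extends to `F : S^n × B → B`. -/
def IsCyclic (n : ℕ) (b : B) (a : Ω^ (Fin n) B b) : Prop :=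
  ∃ F : C((Fin n → I) × B, B),
    (∀ t, F (t, b) = a t) ∧ ∀ t ∈ Cube.boundary (Fin n), ∀ x, F (t, x) = x

theorem isCyclic_const (n : ℕ) (b : B) : IsCyclic n b GenLoop.const :=
  ⟨⟨fun p => p.2, continuous_snd⟩, fun _ => rfl, fun _ _ _ => rfl⟩

theorem IsCyclic.transAt {n : ℕ} {b : B} {p q : Ω^ (Fin n) B b} (i : Fin n)
    (hp : IsCyclic n b p) (hq : IsCyclic n b q) : IsCyclic n b (GenLoop.transAt i p q) := by
  obtain ⟨F, hF, hF'⟩ := hp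
  obtain ⟨G, hG, hG'⟩ := hq
  have bd : ∀ (t : Fin n → I) (s : I), (s = 0 ∨ s = 1) →
      Function.update t i s ∈ Cube.boundary (Fin n) := fun t s hs => ⟨i, by simpa using hs⟩
  have p1 : ∀ r : ℝ, 1 ≤ r → Set.projIcc (0 : ℝ) 1 zero_le_one r = 1 :=
    fun r hr => Set.projIcc_of_right_le _ hr
  have p0 : ∀ r : ℝ, r ≤ 0 → Set.projIcc (0 : ℝ) 1 zero_le_one r = 0 :=
    fun r hr => Set.projIcc_of_le_left _ hr
  refine ⟨⟨fun z => if (z.1 i : ℝ) ≤ 1 / 2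
      then F (Function.update z.1 i (Set.projIcc 0 1 zero_le_one (2 * (z.1 i : ℝ))), z.2)
      else G (Function.update z.1 i (Set.projIcc 0 1 zero_le_one (2 * (z.1 i : ℝ) - 1)), z.2),
      ?_⟩, ?_, ?_⟩
  · refine Continuous.if_le ?_ ?_ (by fun_prop) continuous_const ?_
    · exact F.continuous.comp (by fun_prop)
    · exact G.continuous.comp (by fun_prop)
    · intro z hz
      rw [p1 _ (by linarith), p0 _ (by linarith), hF' _ (bd _ _ (Or.inr rfl)),
        hG' _ (bd _ _ (Or.inl rfl))]
  · intro t
    change ite _ _ _ = ite _ _ _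
    split_ifs
    · exact hF _
    · exact hG _
  · rintro t ⟨j, hj⟩ x
    have key : ∀ s, (j = i → s = 0 ∨ s = 1) →
        Function.update t i s ∈ Cube.boundary (Fin n) := by
      intro s hs
      by_cases h : j = i
      · exact bd t s (hs h)
      · exact ⟨j, by simpa [Function.update_of_ne h] using hj⟩
    change ite _ _ _ = _
    split_ifs with hi
    · apply hF'
      apply key
      rintro rfl
      rcases hj with h | h
      · left; exact p0 _ (by simp [h])
      · right; exact p1 _ (by simp [h])
    · apply hG'
      apply key
      rintro rfl
      rcases hj with h | h
      · left; exact p0 _ (by simp [h])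
      · right; exact p1 _ (by simp only [h]; norm_num)

theorem IsCyclic.symmAt {n : ℕ} {b : B} {p : Ω^ (Fin n) B b} (i : Fin n)
    (hp : IsCyclic n b p) : IsCyclic n b (GenLoop.symmAt i p) := by
  obtain ⟨F, hF, hF'⟩ := hp
  refine ⟨⟨fun z => F (fun j => if j = i then σ (z.1 i) else z.1 j, z.2), ?_⟩, ?_, ?_⟩
  · refine F.continuous.comp (Continuous.prodMk (continuous_pi fun j => ?_) continuous_snd)
    by_cases h : j = i
    · simp only [h, if_true]; fun_prop
    · simp only [h, if_false]; fun_prop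
  · exact fun t => hF _
  · rintro t ⟨j, hj⟩ x
    apply hF'
    refine ⟨j, ?_⟩
    by_cases h : j = i
    · subst h
      simp only [if_true]
      rcases hj with h | h
      · right; simp [h]
      · left; simp [h]
    · simpa [h] using hj

/-- The `(n+1)`st Gottlieb group `G_{n+1}(B) ⊆ π_{n+1}(B)`. -/
def gottlieb (n : ℕ) (b : B) : Subgroup (π_ (n + 1) B b) where
  carrier := {α | ∃ a : Ω^ (Fin (n + 1)) B b, IsCyclic (n + 1) b a ∧ α = piMk (n + 1) a}
  one_mem' := ⟨GenLoop.const, isCyclic_const _ _, rfl⟩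
  mul_mem' := by
    rintro _ _ ⟨p, hp, rfl⟩ ⟨q, hq, rfl⟩
    exact ⟨GenLoop.transAt 0 q p, hq.transAt 0 hp, piMk_mul n p q⟩
  inv_mem' := by
    rintro _ ⟨p, hp, rfl⟩
    exact ⟨GenLoop.symmAt 0 p, hp.symmAt 0, piMk_inv n p⟩

theorem IsCyclic.transAt_comm {n : ℕ} {b : B} {p q : Ω^ (Fin n) B b} (i : Fin n)
    (hp : IsCyclic n b p) :
    GenLoop.Homotopic (GenLoop.transAt i p q) (GenLoop.transAt i q p) := by
  obtain ⟨F, hF, hF'⟩ := hp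
  let c : ℝ → I := Set.projIcc 0 1 zero_le_one
  have hc : Continuous c := continuous_projIcc
  have c1 : ∀ r : ℝ, 1 ≤ r → c r = 1 := fun r hr => Set.projIcc_of_right_le _ hr
  have c0 : ∀ r : ℝ, r ≤ 0 → c r = 0 := fun r hr => Set.projIcc_of_le_left _ hr
  have cc : ∀ x : I, c (x : ℝ) = x := fun x => Set.projIcc_val _ x
  let U : I → I → I := fun s τ => c ((1 - s) * c (2 * τ) + s * c (2 * τ - 1))
  let V : I → I → I := fun s τ => c ((1 - s) * c (2 * τ - 1) + s * c (2 * τ))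
  have bd : ∀ (t : Fin n → I) (s : I), (s = 0 ∨ s = 1) →
      Function.update t i s ∈ Cube.boundary (Fin n) := fun t s hs => ⟨i, by simpa using hs⟩
  have hq0 : ∀ t (s : I), (s = 0 ∨ s = 1) → q (Function.update t i s) = b :=
    fun t s hs => GenLoop.boundary q _ (bd t s hs)
  have hU : Continuous fun z : I × (Fin n → I) => U z.1 (z.2 i) := by
    simp only [U]; fun_prop
  have hV : Continuous fun z : I × (Fin n → I) => V z.1 (z.2 i) := by
    simp only [V]; fun_prop
  refine ⟨⟨⟨⟨fun z => F (Function.update z.2 i (U z.1 (z.2 i)),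
    q (Function.update z.2 i (V z.1 (z.2 i)))), ?_⟩, ?_, ?_⟩, ?_⟩⟩
  · refine F.continuous.comp (Continuous.prodMk (continuous_snd.update i hU) ?_)
    exact q.1.continuous.comp (continuous_snd.update i hV)
  · intro t
    change F (_, _) = ite _ _ _
    have e1 : U 0 (t i) = c (2 * (t i : ℝ)) := by simp [U, cc]
    have e2 : V 0 (t i) = c (2 * (t i : ℝ) - 1) := by simp [V, cc]
    simp only [e1, e2]
    split_ifs with h
    · rw [c0 (2 * (t i : ℝ) - 1) (by linarith), hq0 _ _ (Or.inl rfl)]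
      exact hF _
    · rw [c1 (2 * (t i : ℝ)) (by linarith)]
      exact hF' _ (bd _ _ (Or.inr rfl)) _
  · intro t
    change F (_, _) = ite _ _ _
    have e1 : U 1 (t i) = c (2 * (t i : ℝ) - 1) := by simp [U, cc]
    have e2 : V 1 (t i) = c (2 * (t i : ℝ)) := by simp [V, cc]
    simp only [e1, e2]
    split_ifs with h
    · rw [c0 (2 * (t i : ℝ) - 1) (by linarith)]
      exact hF' _ (bd _ _ (Or.inl rfl)) _
    · rw [c1 (2 * (t i : ℝ)) (by linarith), hq0 _ _ (Or.inr rfl)]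
      exact hF _
  · rintro s t ht
    have hR : GenLoop.transAt i p q t = b := GenLoop.boundary _ t ht
    change F (_, _) = GenLoop.transAt i p q t
    rw [hR]
    obtain ⟨j, hj⟩ := ht
    have key : ∀ r, (j = i → r = 0 ∨ r = 1) →
        Function.update t i r ∈ Cube.boundary (Fin n) := by
      intro r hr
      by_cases h : j = i
      · exact bd t r (hr h)
      · exact ⟨j, by simpa [Function.update_of_ne h] using hj⟩
    have u0 : U s 0 = 0 := by
      simp only [U]; rw [c0 (2 * ((0 : I) : ℝ)) (by simp), c0 (2 * ((0 : I) : ℝ) - 1) (by simp)]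
      exact c0 _ (by simp)
    have v0 : V s 0 = 0 := by
      simp only [V]; rw [c0 (2 * ((0 : I) : ℝ)) (by simp), c0 (2 * ((0 : I) : ℝ) - 1) (by simp)]
      exact c0 _ (by simp)
    have u1 : U s 1 = 1 := by
      simp only [U]
      rw [c1 (2 * ((1 : I) : ℝ)) (by simp), c1 (2 * ((1 : I) : ℝ) - 1) (by norm_num)]
      exact c1 _ (by simp)
    have v1 : V s 1 = 1 := by
      simp only [V]
      rw [c1 (2 * ((1 : I) : ℝ)) (by simp), c1 (2 * ((1 : I) : ℝ) - 1) (by norm_num)]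
      exact c1 _ (by simp)
    have hUb : Function.update t i (U s (t i)) ∈ Cube.boundary (Fin n) := by
      apply key
      rintro rfl
      rcases hj with h | h
      · left; rw [h, u0]
      · right; rw [h, u1]
    have hVb : Function.update t i (V s (t i)) ∈ Cube.boundary (Fin n) := by
      apply key
      rintro rfl
      rcases hj with h | h
      · left; rw [h, v0]
      · right; rw [h, v1]
    dsimp only
    rw [hF' _ hUb]
    exact GenLoop.boundary q _ hVb

theorem gottlieb_le_center (n : ℕ) (b : B) :
    gottlieb n b ≤ Subgroup.center (π_ (n + 1) B b) := by
  rintro _ ⟨p, hp, rfl⟩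
  rw [Subgroup.mem_center_iff]
  intro β
  obtain ⟨q, rfl⟩ := piMk_surjective _ β
  rw [piMk_mul, piMk_mul]
  exact Quotient.sound (hp.transAt_comm 0)

instance gottlieb_normal (n : ℕ) (b : B) : (gottlieb n b).Normal where
  conj_mem g hg h := by
    rw [Subgroup.mem_center_iff.mp (gottlieb_le_center n b hg) h, mul_inv_cancel_right]
    exact hg

end Gottlieb

/-! ### Obstruction groups -/

section Obstruction

variable {E : Type u} {B : Type v} [TopologicalSpace E] [TopologicalSpace B] {e : E} {b : B}

/-- The composite `G_{n+1}(E) → π_{n+1}(B) → π_{n+1}(B) / G_{n+1}(B)` of the restriction of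
`π_{n+1}(f)` with the projection. -/
def obstructionHom (n : ℕ) (f : BasedMap e b) :
    gottlieb n e →* π_ (n + 1) B b ⧸ gottlieb n b :=
  (QuotientGroup.mk' (gottlieb n b)).comp ((piMap n f).comp (gottlieb n e).subtype)

/-- The `(n+1)`st obstruction group `O_{n+1}(f) ⊆ π_{n+1}(B) / G_{n+1}(B)`. -/
def obstruction (n : ℕ) (f : BasedMap e b) : Subgroup (π_ (n + 1) B b ⧸ gottlieb n b) :=
  (obstructionHom n f).range

/-- `O_{n+1}(f)` is commutative, also for `n = 0`, since `G_{n+1}(E)` is. -/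
instance obstructionCommGroup (n : ℕ) (f : BasedMap e b) : CommGroup (obstruction n f) where
  mul_comm := by
    rintro ⟨_, α, rfl⟩ ⟨_, β, rfl⟩
    refine Subtype.ext ?_
    change obstructionHom n f α * obstructionHom n f β
      = obstructionHom n f β * obstructionHom n f α
    rw [← map_mul, ← map_mul]
    congr 1
    exact Subtype.ext (Subgroup.mem_center_iff.mp (gottlieb_le_center n e β.2) α)

/-- `O(f) = ⨁_{n > 0} O_n(f)`, written additively. -/
abbrev ObstructionGroup (f : BasedMap e b) : Type v :=
  ⨁ n : ℕ, Additive (obstruction n f)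

/-- The dimension over `ℚ` of `A ⊗ ℚ`, in `ℕ ∪ {∞}`. If the abelian group `A` is a rational vector
space then `A ≅ A ⊗ ℚ`, and this is its dimension: see `ratDim_eq`. -/
def ratDim (A : Type v) [AddCommGroup A] : ℕ∞ :=
  Cardinal.toENat (Module.rank ℚ (ℚ ⊗[ℤ] A))

theorem ratDim_eq (A : Type v) [AddCommGroup A] [Module ℚ A] :
    ratDim A = Cardinal.toENat (Module.rank ℚ A) := by
  have h : IsLocalizedModule (nonZeroDivisors ℤ) (LinearMap.id : A →ₗ[ℤ] A) :=
    { map_units := fun k => by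
        have hk : ((k : ℤ) : ℚ) ≠ 0 := Int.cast_ne_zero.mpr (nonZeroDivisors.coe_ne_zero k)
        rw [Module.End.isUnit_iff]
        have e : ∀ a : A, algebraMap ℤ (Module.End ℤ A) k a = ((k : ℤ) : ℚ) • a := fun a => by
          simp [Int.cast_smul_eq_zsmul]
        refine ⟨fun a a' haa => ?_, fun a => ⟨((k : ℤ) : ℚ)⁻¹ • a, ?_⟩⟩
        · rw [e, e] at haa
          exact smul_right_injective A hk haa
        · rw [e, smul_smul, mul_inv_cancel₀ hk, one_smul]
      surj := fun a => ⟨(a, 1), by simp⟩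
      exists_of_eq := fun {a a'} haa => ⟨1, by simpa using haa⟩ }
  have hb := (isLocalizedModule_iff_isBaseChange (nonZeroDivisors ℤ) ℚ _).mp h
  rw [ratDim, hb.equiv.rank_eq]

/-- The dimension of the obstruction group `O(f)`. -/
def obstructionDim (f : BasedMap e b) : ℕ∞ :=
  ratDim (ObstructionGroup f)

end Obstruction

/-! ### Complexes of finite type and rationalization -/

/-- `X` is a (Hausdorff) CW complex. -/
def IsCWComplex (X : Type u) [TopologicalSpace X] : Prop :=
  T2Space X ∧ Nonempty (Topology.CWComplex (Set.univ : Set X))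

/-- Singular homology `H_n(X; ℚ)`. -/
def rationalHomology (n : ℕ) (X : Type u) [TopologicalSpace X] : ModuleCat.{u} ℚ :=
  ((AlgebraicTopology.singularHomologyFunctor (ModuleCat.{u} ℚ) n).obj
    (ModuleCat.of ℚ (ULift.{u} ℚ))).obj (TopCat.of X)

/-- `X` is a simply connected CW complex whose rational homology is of finite type, that is,
finite-dimensional in each degree. -/
structure IsSimplyConnectedFiniteType (X : Type u) [TopologicalSpace X] : Prop where
  isCWComplex : IsCWComplex X
  simplyConnected : SimplyConnectedSpace X
  finiteType : ∀ n, Module.Finite ℚ (rationalHomology n X)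

section Rationalization

variable {X XQ : Type*} [TopologicalSpace X] [TopologicalSpace XQ]

/-- `η : X → X_ℚ` is a rationalization of the simply connected space `X`: the space `X_ℚ` is a
simply connected CW complex and, for every `n ≥ 2`, the homomorphism
`π_n(η) : π_n(X) → π_n(X_ℚ)` is the localization of the abelian group `π_n(X)` at the nonzero
integers. In other words, `π_n(X_ℚ)` is a rational vector space and `π_n(η)` induces an isomorphism
`π_n(X) ⊗ ℚ ≅ π_n(X_ℚ)`. -/
structure IsRationalization {x : X} {xQ : XQ} (η : BasedMap x xQ) : Prop where
  isCWComplex : IsCWComplex XQ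
  simplyConnected : SimplyConnectedSpace XQ
  isLocalized : ∀ n : ℕ, IsLocalizedModule (nonZeroDivisors ℤ)
    (MonoidHom.toAdditive (piMap (n + 1) η)).toIntLinearMap

variable {Y YQ : Type*} [TopologicalSpace Y] [TopologicalSpace YQ]

/-- `f_ℚ : X_ℚ → Y_ℚ` is a rationalization of `f : X → Y`, with respect to given rationalizations
of `X` and `Y`: the square `f_ℚ ∘ η_X ≃ η_Y ∘ f` commutes up to based homotopy. -/
def IsRationalizationOfMap {x : X} {xQ : XQ} {y : Y} {yQ : YQ} (ηX : BasedMap x xQ)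
    (ηY : BasedMap y yQ) (f : BasedMap x y) (fQ : BasedMap xQ yQ) : Prop :=
  (fQ.comp ηX).Homotopic (ηY.comp f)

end Rationalization

end GottliebObstruction

end

namespace GottliebObstruction

open Cardinal

universe u₁ u₂ u₃

/-! ### Functoriality of the homomorphisms induced by based maps -/

section Functoriality

variable {X : Type u₁} {Y : Type u₂} {Z : Type u₃}
  [TopologicalSpace X] [TopologicalSpace Y] [TopologicalSpace Z] {x : X} {y : Y} {z : Z}

/-! Let `h` induce the same maps on homotopy groups as `f ∘ g`. If a Gottlieb class `α` of the
source dies in `O_n(g)`, then `g_* α` is itself a Gottlieb class, so `h_* α = f_* (g_* α)`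
represents an element of `O_n(f)`. Hence `O_n(g)` maps onto `O_n(h) / (O_n(h) ∩ O_n(f))`, and ranks
give `rk O_n(h) ≤ rk O_n(f) + rk O_n(g)` (`lift_rank_obstruction_le`); summing over `n` gives
`obstructionDim_le_add`.

Rationality enters only through `IsRationalization.piMap_ext`: a chosen rationalization of the
composite need not be `f_ℚ ∘ g_ℚ`, but the two agree up to homotopy after `η_X`, hence agree on
homotopy groups. Dimensions are computed as ranks over `ℤ`, so the obstruction groups need no
`ℚ`-structure. -/

theorem piMap_comp (n : ℕ) (f : BasedMap y z) (g : BasedMap x y) :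
    piMap n (f.comp g) = (piMap n f).comp (piMap n g) := by
  ext α
  obtain ⟨a, rfl⟩ := piMk_surjective _ α
  rfl

theorem piMap_eq_of_homotopic (n : ℕ) {f g : BasedMap x y} (h : f.Homotopic g) :
    piMap n f = piMap n g := by
  ext α
  obtain ⟨a, rfl⟩ := piMk_surjective _ α
  obtain ⟨F⟩ := h
  refine Quotient.sound ⟨⟨⟨⟨fun p => F (p.1, a p.2), ?_⟩, ?_, ?_⟩, ?_⟩⟩
  · exact F.continuous.comp (continuous_fst.prodMk (a.1.continuous.comp continuous_snd))
  · exact fun t => F.map_zero_left _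
  · exact fun t => F.map_one_left _
  · intro s t ht
    exact F.prop' s (a t) (GenLoop.boundary a t ht)

theorem subsingleton_pi_one (x : X) [SimplyConnectedSpace X] : Subsingleton (π_ 1 X x) :=
  (HomotopyGroup.pi1EquivFundamentalGroup (X := X) (x := x)).subsingleton

/-- Homomorphisms between the homotopy groups of rationalizations are determined by their
composites with the rationalization of the source. -/
theorem IsRationalization.piMap_ext {XQ YQ : Type*} [TopologicalSpace XQ] [TopologicalSpace YQ]
    {xQ : XQ} {yQ : YQ} {ηX : BasedMap x xQ} {ηY : BasedMap y yQ} (hX : IsRationalization ηX)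
    (hY : IsRationalization ηY) {f g : BasedMap xQ yQ}
    (h : (f.comp ηX).Homotopic (g.comp ηX)) (n : ℕ) : piMap n f = piMap n g := by
  have hn := piMap_eq_of_homotopic n h
  rw [piMap_comp, piMap_comp] at hn
  cases n with
  -- This is `π_1`, where `IsRationalization` imposes no localization; the source group is trivial
  -- instead.
  | zero =>
    have := hX.simplyConnected
    have := subsingleton_pi_one xQ
    ext α
    rw [Subsingleton.elim α 1, map_one, map_one]
  | succ n =>
    have := hX.isLocalized n
    have := hY.isLocalized n
    have key : (MonoidHom.toAdditive (piMap (n + 1) f)).toIntLinearMap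
        = (MonoidHom.toAdditive (piMap (n + 1) g)).toIntLinearMap := by
      -- Uniqueness of the extension along `η_X` needs nonzero integers to act invertibly on the
      -- target, which is where `hY` is used.
      refine IsLocalizedModule.linearMap_ext (nonZeroDivisors ℤ)
        (MonoidHom.toAdditive (piMap (n + 1) ηX)).toIntLinearMap
        (MonoidHom.toAdditive (piMap (n + 1) ηY)).toIntLinearMap ?_
      ext α
      exact congrArg Additive.ofMul (DFunLike.congr_fun hn α.toMul)
    ext α
    exact congrArg Additive.toMul (DFunLike.congr_fun key (Additive.ofMul α))

theorem BasedMap.Homotopic.comp_left {f g : BasedMap x y} (h : f.Homotopic g)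
    (k : BasedMap y z) : (k.comp f).Homotopic (k.comp g) :=
  h.comp_continuousMap k.toMap

theorem BasedMap.Homotopic.comp_right {f g : BasedMap y z} (h : f.Homotopic g)
    (k : BasedMap x y) : (f.comp k).Homotopic (g.comp k) := by
  obtain ⟨F⟩ := h
  refine ⟨⟨⟨⟨fun p => F (p.1, k.toMap p.2), ?_⟩, ?_, ?_⟩, ?_⟩⟩
  · exact F.continuous.comp (continuous_fst.prodMk (k.toMap.continuous.comp continuous_snd))
  · exact fun t => F.map_zero_left _
  · exact fun t => F.map_one_left _
  · rintro s t rfl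
    exact F.prop' s (k.toMap t) k.map_base

/-- Rationalizations of based maps compose. -/
theorem IsRationalizationOfMap.comp {XQ YQ ZQ : Type*} [TopologicalSpace XQ]
    [TopologicalSpace YQ] [TopologicalSpace ZQ] {xQ : XQ} {yQ : YQ} {zQ : ZQ}
    {ηX : BasedMap x xQ} {ηY : BasedMap y yQ} {ηZ : BasedMap z zQ}
    {f : BasedMap y z} {g : BasedMap x y} {fQ : BasedMap yQ zQ} {gQ : BasedMap xQ yQ}
    (hf : IsRationalizationOfMap ηY ηZ f fQ) (hg : IsRationalizationOfMap ηX ηY g gQ) :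
    IsRationalizationOfMap ηX ηZ (f.comp g) (fQ.comp gQ) :=
  (BasedMap.Homotopic.comp_left hg fQ).trans (BasedMap.Homotopic.comp_right hf g)

end Functoriality

/-! ### Ranks of abelian groups -/

section Rank

/-- Base change to the fraction ring is localization at the non-zero-divisors, which preserves rank;
moreover a `K`-module has the same rank over `K` as over `R`. -/
theorem rank_fractionRing_tensor (R : Type u₁) (K : Type u₂) (A : Type u₃) [CommRing R]
    [CommRing K] [Algebra R K] [IsFractionRing R K] [AddCommGroup A] [Module R A] :
    Module.rank K (K ⊗[R] A) = lift.{u₂} (Module.rank R A) := by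
  have : IsLocalizedModule (nonZeroDivisors R) (TensorProduct.mk R K A 1) :=
    (isLocalizedModule_iff_isBaseChange (nonZeroDivisors R) K _).mpr
      (TensorProduct.isBaseChange R A K)
  have h := IsLocalizedModule.lift_rank_eq (nonZeroDivisors R) (TensorProduct.mk R K A 1) le_rfl
  rw [IsLocalization.rank_eq K (nonZeroDivisors R) le_rfl]
  rwa [lift_umax.{u₃, u₂}, lift_id'.{u₃, u₂}] at h

theorem ratDim_directSum (A : ℕ → Type u₁) [∀ n, AddCommGroup (A n)] :
    ratDim (⨁ n, A n) = toENat (Cardinal.sum fun n => Module.rank ℤ (A n)) := by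
  rw [ratDim, (TensorProduct.directSumRight ℤ ℚ ℚ A).rank_eq, rank_directSum]
  simp_rw [rank_fractionRing_tensor, lift_uzero]

/-- Subadditivity of the rank: `S` embeds in `B`, and `C` maps onto `A ⧸ S`. -/
theorem lift_rank_le_add {A B : Type u₁} {C : Type u₂} [CommGroup A] [CommGroup B]
    [CommGroup C] (S : Subgroup A) (i : S →* B) (hi : Function.Injective i)
    (p : C →* A ⧸ S) (hp : Function.Surjective p) :
    lift.{u₂} (Module.rank ℤ (Additive A))
      ≤ lift.{u₂} (Module.rank ℤ (Additive B)) + lift.{u₁} (Module.rank ℤ (Additive C)) := by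
  let q := (MonoidHom.toAdditive (QuotientGroup.mk' S)).toIntLinearMap
  have hq : Function.Surjective q := QuotientGroup.mk'_surjective S
  have hS : ∀ a : LinearMap.ker q, a.1.toMul ∈ S := fun a => (QuotientGroup.eq_one_iff _).mp a.2
  let j : LinearMap.ker q →ₗ[ℤ] Additive B :=
    AddMonoidHom.toIntLinearMap
      { toFun := fun a => Additive.ofMul (i ⟨a.1.toMul, hS a⟩)
        map_zero' := congrArg Additive.ofMul (map_one i)
        map_add' := fun a b =>
          congrArg Additive.ofMul (map_mul i ⟨a.1.toMul, hS a⟩ ⟨b.1.toMul, hS b⟩) }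
  have hj : Function.Injective j := fun a b hab =>
    Subtype.ext (Subtype.ext_iff.mp (hi hab) :)
  -- Rank–nullity over `ℤ` for the projection `q`, whose kernel is `S`.
  rw [LinearMap.rank_eq_of_surjective hq, lift_add, add_comm]
  exact add_le_add (lift_le.mpr (LinearMap.rank_le_of_injective j hj))
    (LinearMap.lift_rank_le_of_surjective (MonoidHom.toAdditive p).toIntLinearMap hp)

end Rank

/-! ### Obstruction groups of composites -/

section Composite

variable {X : Type u₁} {Y : Type u₂} {Z : Type u₃}
  [TopologicalSpace X] [TopologicalSpace Y] [TopologicalSpace Z] {x : X} {y : Y} {z : Z}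

theorem lift_rank_obstruction_le (n : ℕ) {f : BasedMap y z} {g : BasedMap x y}
    {h : BasedMap x z} (hfg : piMap n h = (piMap n f).comp (piMap n g)) :
    lift.{u₂} (Module.rank ℤ (Additive (obstruction n h)))
      ≤ lift.{u₂} (Module.rank ℤ (Additive (obstruction n f)))
        + lift.{u₃} (Module.rank ℤ (Additive (obstruction n g))) := by
  -- The intersection of `O(h)` and `O(f)`, both subgroups of the same quotient of `π_{n+1}(Z)`.
  let S := (obstruction n f).subgroupOf (obstruction n h)
  let i : S →* obstruction n f :=
    { toFun := fun s => ⟨s.1.1, s.2⟩, map_one' := rfl, map_mul' := fun _ _ => rfl }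
  have hi : Function.Injective i := fun s t hst =>
    Subtype.ext (Subtype.ext (Subtype.ext_iff.mp hst :))
  let φ : gottlieb n x →* obstruction n h ⧸ S :=
    (QuotientGroup.mk' S).comp (obstructionHom n h).rangeRestrict
  -- The crux: if `g_* α` is a Gottlieb class, it witnesses that the class of `h_* α` lies in
  -- `O(f)`. So `φ` descends to `O(g)`.
  have hφ : (obstructionHom n g).rangeRestrict.ker ≤ φ.ker := by
    intro α hα
    rw [MonoidHom.ker_rangeRestrict, MonoidHom.mem_ker] at hα
    have hα' : piMap n g α.1 ∈ gottlieb n y := (QuotientGroup.eq_one_iff _).mp hα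
    refine (QuotientGroup.eq_one_iff _).mpr ⟨⟨_, hα'⟩, ?_⟩
    change QuotientGroup.mk (piMap n f (piMap n g α.1)) = QuotientGroup.mk (piMap n h α.1)
    rw [hfg]
    rfl
  have hs := (obstructionHom n g).rangeRestrict_surjective
  let p : obstruction n g →* obstruction n h ⧸ S := MonoidHom.liftOfSurjective _ hs ⟨φ, hφ⟩
  have hp : Function.Surjective p := by
    intro c
    obtain ⟨b, rfl⟩ := QuotientGroup.mk'_surjective S c
    obtain ⟨α, rfl⟩ := (obstructionHom n h).rangeRestrict_surjective b
    exact ⟨_, MonoidHom.liftOfRightInverse_comp_apply _ _ (Function.rightInverse_surjInv hs)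
      ⟨φ, hφ⟩ α⟩
  exact lift_rank_le_add S i hi p hp

theorem obstructionDim_le_add {f : BasedMap y z} {g : BasedMap x y} {h : BasedMap x z}
    (hfg : ∀ n, piMap n h = (piMap n f).comp (piMap n g)) :
    obstructionDim h ≤ obstructionDim f + obstructionDim g := by
  simp only [obstructionDim, ObstructionGroup, ratDim_directSum]
  -- The groups for `f` and `h` live over `Z`, those for `g` over `Y`: lifting to a common universe
  -- reduces the claim to a termwise inequality of cardinals, to which the monotone `toENat` is
  -- applied.
  rw [← toENat_lift.{u₃, u₂} (c := Cardinal.sum fun n => Module.rank ℤ (Additive (obstruction n h))),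
    ← toENat_lift.{u₃, u₂} (c := Cardinal.sum fun n => Module.rank ℤ (Additive (obstruction n f))),
    ← toENat_lift.{u₂, u₃}, ← map_add]
  refine OrderHomClass.mono toENat ?_
  simp only [lift_sum]
  rw [← sum_add_distrib']
  exact sum_le_sum _ _ fun n => lift_rank_obstruction_le n (hfg n)

end Composite

end GottliebObstruction

theorem theorem1p2 {X Y Z XQ YQ ZQ : Type*}
    [TopologicalSpace X] [TopologicalSpace Y] [TopologicalSpace Z]
    [TopologicalSpace XQ] [TopologicalSpace YQ] [TopologicalSpace ZQ]
    (hX : GottliebObstruction.IsSimplyConnectedFiniteType X)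
    (hY : GottliebObstruction.IsSimplyConnectedFiniteType Y)
    (hZ : GottliebObstruction.IsSimplyConnectedFiniteType Z)
    {x : X} {y : Y} {z : Z} {xQ : XQ} {yQ : YQ} {zQ : ZQ}
    (ηX : GottliebObstruction.BasedMap x xQ) (ηY : GottliebObstruction.BasedMap y yQ)
    (ηZ : GottliebObstruction.BasedMap z zQ)
    (hηX : GottliebObstruction.IsRationalization ηX)
    (hηY : GottliebObstruction.IsRationalization ηY)
    (hηZ : GottliebObstruction.IsRationalization ηZ)
    (f : GottliebObstruction.BasedMap y z) (g : GottliebObstruction.BasedMap x y)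
    (fQ : GottliebObstruction.BasedMap yQ zQ) (gQ : GottliebObstruction.BasedMap xQ yQ)
    (fgQ : GottliebObstruction.BasedMap xQ zQ)
    (hfQ : GottliebObstruction.IsRationalizationOfMap ηY ηZ f fQ)
    (hgQ : GottliebObstruction.IsRationalizationOfMap ηX ηY g gQ)
    (hfgQ : GottliebObstruction.IsRationalizationOfMap ηX ηZ (f.comp g) fgQ) :
    GottliebObstruction.obstructionDim fgQ ≤
      GottliebObstruction.obstructionDim fQ + GottliebObstruction.obstructionDim gQ := by
  refine GottliebObstruction.obstructionDim_le_add fun n => ?_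
  rw [← GottliebObstruction.piMap_comp]
  -- After `η_X`, both maps are homotopic to `η_Z ∘ f ∘ g`.
  exact hηX.piMap_ext hηZ (hfgQ.trans (hfQ.comp hgQ).symm) n
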